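/- Let $\mathcal X,\mathcal Y$ be finite sets with $|\mathcal X|=|\mathcal Y|=m$, let $P$ be a probability mass function on $\mathcal X\times\mathcal Y$ with positive marginals $P_X,P_Y$, and let $p_\star=\min\{\min_xP_X(x),\min_yP_Y(y)\}$. Let $\hat P_X,\hat P_Y$ be probability mass functions on $\mathcal X,\mathcal Y$ with all masses positive, let $\epsilon\in[0,1)$, and put $$\hat P_{X,\epsilon}=(1-\epsilon)P_X+\epsilon\hat P_X,\qquad \hat P_{Y,\epsilon}=(1-\epsilon)P_Y+\epsilon\hat P_Y,\qquad \hat p_{\star,\epsilon}=\min\{\min_x\hat P_{X,\epsilon}(x),\min_y\hat P_{Y,\epsilon}(y)\}.$$ Let $(X_1,Y_1),\dots,(X_n,Y_n)$, $n\ge1$, be i.i.d. from $P$ with empirical measure $P_n$. Define $\hat P_n^{(0)}=P_n$ and, for $k\ge1$, $$\hat P_n^{(k)}(x,y)=\frac{\hat P_{X,\epsilon}(x)}{\hat P_{n,X}^{(k-1)}(x)}\hat P_n^{(k-1)}(x,y)\ (k\text{ odd}),\qquad \hat P_n^{(k)}(x,y)=\frac{\hat P_{Y,\epsilon}(y)}{\hat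 P_{n,Y}^{(k-1)}(y)}\hat P_n^{(k-1)}(x,y)\ (k\text{ even}),$$ where $Q_X,Q_Y$ denote the marginals of $Q$. These are well defined on the event $\mathcal S=\{\operatorname{Supp}P_{n,X}=\operatorname{Supp}P_X,\ \operatorname{Supp}P_{n,Y}=\operatorname{Supp}P_Y\}$; off $\mathcal S$ the estimator uses $P_n$. For $h:\mathcal X\times\mathcal Y\to\mathbb R$ write $Q(h)=\sum_{x,y}h(x,y)Q(x,y)$ and $\|h\|_\infty=\max|h|$. Let $\mathcal C_k h=h-\mathbb E_P[h(X,Y)\mid X]$ for $k$ odd, $\mathcal C_kh=h-\mathbb E_P[h(X,Y)\mid Y]$ for $k$ even, and $\sigma_k^2=\operatorname{Var}_P(\mathcal C_1\cdots\mathcal C_kh)$. Write $L_\epsilon=\log\frac1{1-\epsilon}$. There exist an absolute constant $C>0$, an absolute exponent $a\in\mathbb N$, and for every $m$ a constant $K_m>0$ depending only on $m$, such that for all $\mathcal X,\mathcal Y,P,\hat P_X,\hat P_Y,\epsilon,h$ as above and all $k,n\ge1$ with $$n\ \ge\ \frac{C\,[\log_2(2n/\hat p_{\star,\epsilon})+m\log(n+1)]}{\min\{p_\star,\hat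 p_{\star,\epsilon}\}^2},$$ one has, with $\Lambda_n=K_m\|h\|_\infty^2\,(\log(n+1))^a$, $$\begin{aligned} &\mathbb E\big[(\hat P_n^{(k)}(h)-P(h))^2\mathbf 1_{\mathcal S}\big]+\mathbb E\big[(P_n(h)-P(h))^2\mathbf 1_{\mathcal S^c}\big]\ \le\ \frac{\sigma_k^2}{n}+\Lambda_n\frac{k^6}{\hat p_{\star,\epsilon}^4\,n^{3/2}}\\ &\quad+\Lambda_n\frac{k^4}{\hat p_{\star,\epsilon}^2}\Big(\sqrt{\tfrac{L_\epsilon}n}+L_\epsilon\Big)\Big[\frac{k^2}{\hat p_{\star,\epsilon}^2}\Big(\sqrt{\tfrac{L_\epsilon}n}+L_\epsilon+\frac1n\Big)+\frac1{\sqrt n}\Big]\\ &\quad+\Lambda_n k^2\Big[\sqrt\epsilon\Big(\frac{\hat p_{\star,\epsilon}^4}{n^4}+\frac1{\sqrt n}+\frac{\hat p_{\star,\epsilon}^2k}{n^4}\Big(n+\frac{k^2}{\hat p_{\star,\epsilon}^2}\Big)+\frac{k^2}{\hat p_{\star,\epsilon}^2}\Big[\frac1n+\sqrt{\tfrac{L_\epsilon}n}+L_\epsilon\Big]\Big)+\epsilon\Big].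 \end{aligned}$$ -/

import Mathlib

open MeasureTheory ProbabilityTheory

noncomputable section

namespace Balancing

variable {𝒳 𝒴 : Type*} [Fintype 𝒳] [Fintype 𝒴]

/-- The `𝒳`-marginal `Q_X(x) = ∑ y, Q(x, y)` of a mass function `Q` on `𝒳 × 𝒴`. -/
def marginX (Q : 𝒳 × 𝒴 → ℝ) (x : 𝒳) : ℝ := ∑ y, Q (x, y)

/-- The `𝒴`-marginal `Q_Y(y) = ∑ x, Q(x, y)` of a mass function `Q` on `𝒳 × 𝒴`. -/
def marginY (Q : 𝒳 × 𝒴 → ℝ) (y : 𝒴) : ℝ := ∑ x, Q (x, y)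

/-- The expectation `Q(h) = ∑ (x, y), h(x, y) Q(x, y)`. -/
def expect (Q h : 𝒳 × 𝒴 → ℝ) : ℝ := ∑ z, h z * Q z

/-- The variance of `g(X, Y)` under `Q`. -/
def variance (Q g : 𝒳 × 𝒴 → ℝ) : ℝ := expect Q (fun z => (g z - expect Q g) ^ 2)

/-- The conditional mean operator `[μ_X h](x, y) = E_P[h(X, Y) | X](x)`. -/
def condMeanX (P h : 𝒳 × 𝒴 → ℝ) : 𝒳 × 𝒴 → ℝ :=
  fun z => (∑ y, h (z.1, y) * P (z.1, y)) / marginX P z.1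

/-- The conditional mean operator `[μ_Y h](x, y) = E_P[h(X, Y) | Y](y)`. -/
def condMeanY (P h : 𝒳 × 𝒴 → ℝ) : 𝒳 × 𝒴 → ℝ :=
  fun z => (∑ x, h (x, z.2) * P (x, z.2)) / marginY P z.2

/-- The debiasing operator `C_k`: it is `C_X = I - μ_X` for `k` odd and `C_Y = I - μ_Y` for
`k` even. -/
def debias (P : 𝒳 × 𝒴 → ℝ) (k : ℕ) (h : 𝒳 × 𝒴 → ℝ) : 𝒳 × 𝒴 → ℝ :=
  if Odd k then h - condMeanX P h else h - condMeanY P h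

/-- The iterated debiasing `C_1 C_2 ⋯ C_k h` (the operator `C_k` acts first). -/
def debiasIter (P : 𝒳 × 𝒴 → ℝ) : ℕ → (𝒳 × 𝒴 → ℝ) → (𝒳 × 𝒴 → ℝ)
  | 0, h => h
  | k + 1, h => debiasIter P k (debias P (k + 1) h)

/-- `σ_k² = Var(C_1 ⋯ C_k h)`. -/
def sigmaSq (P h : 𝒳 × 𝒴 → ℝ) (k : ℕ) : ℝ := variance P (debiasIter P k h)

/-- The mixture `(1 - ε) p + ε p'`. -/
def mixture {S : Type*} (ε : ℝ) (p p' : S → ℝ) (s : S) : ℝ := (1 - ε) * p s + ε * p' s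

/-- The smallest mass `min {min_x p(x), min_y r(y)}`. -/
def minMass (p : 𝒳 → ℝ) (r : 𝒴 → ℝ) : ℝ := min (⨅ x, p x) (⨅ y, r y)

/-- The balancing iterations with target marginals `(μ, ν)` started at `R`: the rows are rescaled
to have `𝒳`-marginal `μ` in the odd steps, and the columns are rescaled to have `𝒴`-marginal `ν`
in the even steps. -/
def balance (μ : 𝒳 → ℝ) (ν : 𝒴 → ℝ) (R : 𝒳 × 𝒴 → ℝ) : ℕ → (𝒳 × 𝒴 → ℝ)
  | 0 => R
  | k + 1 => fun z =>
      if Odd (k + 1) then μ z.1 / marginX (balance μ ν R k) z.1 * balance μ ν R k z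
      else ν z.2 / marginY (balance μ ν R k) z.2 * balance μ ν R k z

/-- The empirical measure `P_n` of a sample `z_1, …, z_n` of points of `𝒳 × 𝒴`. -/
def empirical {n : ℕ} (z : Fin n → 𝒳 × 𝒴) : 𝒳 × 𝒴 → ℝ :=
  fun w => (∑ i, Set.indicator {w} (fun _ => (1 : ℝ)) (z i)) / n

/-- The condition `Supp P_{n,X} = Supp P_X` and `Supp P_{n,Y} = Supp P_Y` on the empirical
measure `Pn`. -/
def SameSupports (Pn P : 𝒳 × 𝒴 → ℝ) : Prop :=
  {x | 0 < marginX Pn x} = {x | 0 < marginX P x} ∧ {y | 0 < marginY Pn y} = {y | 0 < marginY P y}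

/-- The mean squared error of the `k`-step balanced estimator of `P(h)` with target marginals
`(μ, ν)`, computed from the random sample `Z_1, …, Z_n`; the estimator falls back to `P_n(h)` off
the event `S` that the supports agree:
`E[(P_n⁽ᵏ⁾(h) - P(h))² 1_S] + E[(P_n(h) - P(h))² 1_{Sᶜ}]`. -/
def mse {Ω : Type*} [MeasurableSpace Ω] (ρ : Measure Ω) {n : ℕ} (Z : Fin n → Ω → 𝒳 × 𝒴)
    (P h : 𝒳 × 𝒴 → ℝ) (μ : 𝒳 → ℝ) (ν : 𝒴 → ℝ) (k : ℕ) : ℝ :=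
  let Pn : Ω → 𝒳 × 𝒴 → ℝ := fun ω => empirical (fun i => Z i ω)
  let S : Set Ω := {ω | SameSupports (Pn ω) P}
  (∫ ω, S.indicator (fun ω => (expect (balance μ ν (Pn ω) k) h - expect P h) ^ 2) ω ∂ρ)
    + ∫ ω, Sᶜ.indicator (fun ω => (expect (Pn ω) h - expect P h) ^ 2) ω ∂ρ

end Balancing

end

namespace Balancing

variable {𝒳 𝒴 : Type*} [Fintype 𝒳] [Fintype 𝒴]

/-! The two target marginals come from one joint law, `P' = (1 - ε) P + ε (QX ⊗ QY)`, which is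
within `2ε` of `P` in ℓ¹. So the iteration balances the empirical measure `R` towards the marginals
of a law close to `P`.

One balancing step obeys an exact identity (`expect_balance_succ_sub`): the error at `g` is the
error of the previous iterate at the debiased `g`, plus a product of two small quantities (scaling
factor minus one, iterate minus `P`), plus a bias from `P' - P`. Unrolling `k` steps
(`abs_error_sub_le`) leaves the empirical error of `C_1 ⋯ C_k h`, whose mean square is exactly `σ_k²
/ n`.

For the rest, let `t = √n ‖R - P‖₁`, let `q` be the least target mass, `H` a bound on `|h|` and `s =
2 (t/√n + 2ε) / q`. If `s ≤ 1`, three estimates hold uniformly along the iteration: scaling factors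
are within `3s` of one (`closeFibres_balance`), iterates are within `4ks` of `P` in ℓ¹
(`sum_abs_balance_sub_le`), and the debiased functions are at most `3kH`
(`DebiasBound.abs_debiasIter_le`). The unrolled remainder is then at most `H (36 k³ s² + 4kε)`.

If `s` may exceed one, or the supports differ, then `t/√n` or `ε` is at least of order `q`, and the
trivial bound `4H²` on the squared error is already dominated by `remainder * (1 + t⁴)`
(`one_le_mul_remainder`). Both regimes thus give one pointwise bound (`sq_error_le`,
`sq_error_le_of_not_sameSupports`). Integrating it needs only a fourth moment of `t`, which
Hoeffding's lemma bounds independently of `n`; no logarithm enters. -/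

/-- The marginal of `Q` in the coordinate that step `j` balances, as a function on `𝒳 × 𝒴`. -/
noncomputable def fibreSum (j : ℕ) (Q : 𝒳 × 𝒴 → ℝ) (z : 𝒳 × 𝒴) : ℝ :=
  if Odd j then marginX Q z.1 else marginY Q z.2

/-- Functions on `𝒳 × 𝒴` of the coordinate that step `j` balances. -/
def IsFibreConst (j : ℕ) (u : 𝒳 × 𝒴 → ℝ) : Prop :=
  if Odd j then ∀ x y y', u (x, y) = u (x, y') else ∀ x x' y, u (x, y) = u (x', y)

/-- The conditional mean that `debias` subtracts in step `j`. -/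
noncomputable def condMean (P : 𝒳 × 𝒴 → ℝ) (j : ℕ) (h : 𝒳 × 𝒴 → ℝ) (z : 𝒳 × 𝒴) : ℝ :=
  fibreSum j (fun w => h w * P w) z / fibreSum j P z

/-! ### Fibre sums, treating row and column steps uniformly through the parity of the step -/

theorem fibreSum_add_two (j : ℕ) (Q : 𝒳 × 𝒴 → ℝ) : fibreSum (j + 2) Q = fibreSum j Q := by
  funext z
  simp [fibreSum, Nat.odd_add]

theorem condMean_add_two (P : 𝒳 × 𝒴 → ℝ) (j : ℕ) (h : 𝒳 × 𝒴 → ℝ) :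
    condMean P (j + 2) h = condMean P j h := by
  funext z
  simp [condMean, fibreSum_add_two]

theorem debias_apply (P : 𝒳 × 𝒴 → ℝ) (j : ℕ) (h : 𝒳 × 𝒴 → ℝ) (z : 𝒳 × 𝒴) :
    debias P j h z = h z - condMean P j h z := by
  unfold debias condMean fibreSum
  split_ifs <;> simp [condMeanX, condMeanY, marginX, marginY]

theorem isFibreConst_fibreSum (j : ℕ) (Q : 𝒳 × 𝒴 → ℝ) : IsFibreConst j (fibreSum j Q) := by
  unfold IsFibreConst fibreSum
  split_ifs <;> intros <;> rfl

omit [Fintype 𝒳] [Fintype 𝒴] in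
theorem IsFibreConst.comp₂ {j : ℕ} {u v : 𝒳 × 𝒴 → ℝ} (hu : IsFibreConst j u)
    (hv : IsFibreConst j v) (f : ℝ → ℝ → ℝ) : IsFibreConst j (fun z => f (u z) (v z)) := by
  unfold IsFibreConst at *
  split_ifs at * with hj
  · intro x y y'
    simp only [hu x y y', hv x y y']
  · intro x x' y
    simp only [hu x x' y, hv x x' y]

theorem isFibreConst_condMean (P : 𝒳 × 𝒴 → ℝ) (j : ℕ) (h : 𝒳 × 𝒴 → ℝ) :
    IsFibreConst j (condMean P j h) :=
  (isFibreConst_fibreSum j _).comp₂ (isFibreConst_fibreSum j P) (· / ·)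

theorem fibreSum_mul {j : ℕ} {u : 𝒳 × 𝒴 → ℝ} (hu : IsFibreConst j u) (Q : 𝒳 × 𝒴 → ℝ)
    (z : 𝒳 × 𝒴) : fibreSum j (fun w => u w * Q w) z = u z * fibreSum j Q z := by
  obtain ⟨x, y⟩ := z
  unfold IsFibreConst at hu
  unfold fibreSum
  split_ifs at * with hj
  · simp only [marginX, Finset.mul_sum]
    exact Finset.sum_congr rfl fun y' _ => by rw [hu x y' y]
  · simp only [marginY, Finset.mul_sum]
    exact Finset.sum_congr rfl fun x' _ => by rw [hu x' x y]

theorem fibreSum_mono (j : ℕ) {Q Q' : 𝒳 × 𝒴 → ℝ} (h : ∀ z, Q z ≤ Q' z) (z : 𝒳 × 𝒴) :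
    fibreSum j Q z ≤ fibreSum j Q' z := by
  unfold fibreSum
  split_ifs <;> exact Finset.sum_le_sum fun _ _ => h _

theorem fibreSum_sub (j : ℕ) (Q Q' : 𝒳 × 𝒴 → ℝ) (z : 𝒳 × 𝒴) :
    fibreSum j (fun w => Q w - Q' w) z = fibreSum j Q z - fibreSum j Q' z := by
  unfold fibreSum
  split_ifs <;> simp [marginX, marginY]

theorem fibreSum_const_mul (j : ℕ) (c : ℝ) (Q : 𝒳 × 𝒴 → ℝ) (z : 𝒳 × 𝒴) :
    fibreSum j (fun w => c * Q w) z = c * fibreSum j Q z := by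
  unfold fibreSum
  split_ifs <;> simp [marginX, marginY, Finset.mul_sum]

theorem abs_fibreSum_le (j : ℕ) (Q : 𝒳 × 𝒴 → ℝ) (z : 𝒳 × 𝒴) :
    |fibreSum j Q z| ≤ fibreSum j (fun w => |Q w|) z := by
  unfold fibreSum
  split_ifs <;> exact Finset.abs_sum_le_sum_abs _ _

theorem fibreSum_le_sum (j : ℕ) {Q : 𝒳 × 𝒴 → ℝ} (hQ : ∀ z, 0 ≤ Q z) (z : 𝒳 × 𝒴) :
    fibreSum j Q z ≤ ∑ w, Q w := by
  unfold fibreSum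
  split_ifs
  · rw [Fintype.sum_prod_type]
    exact Finset.single_le_sum (f := marginX Q)
      (fun x _ => Finset.sum_nonneg fun y _ => hQ (x, y)) (Finset.mem_univ z.1)
  · rw [Fintype.sum_prod_type_right]
    exact Finset.single_le_sum (f := marginY Q)
      (fun y _ => Finset.sum_nonneg fun x _ => hQ (x, y)) (Finset.mem_univ z.2)

/-- Total mass is the sum of the fibre sums. This turns fibrewise identities, such as exact
marginals after a step or vanishing conditional means, into identities between expectations. -/
theorem sum_eq_sum_of_fibreSum_eq (j : ℕ) {Q Q' : 𝒳 × 𝒴 → ℝ}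
    (h : ∀ z, fibreSum j Q z = fibreSum j Q' z) : ∑ z, Q z = ∑ z, Q' z := by
  unfold fibreSum at h
  split_ifs at h
  · rw [Fintype.sum_prod_type, Fintype.sum_prod_type]
    refine Finset.sum_congr rfl fun x _ => ?_
    rcases isEmpty_or_nonempty 𝒴 with _ | ⟨⟨y⟩⟩
    · simp
    · exact h (x, y)
  · rw [Fintype.sum_prod_type_right, Fintype.sum_prod_type_right]
    refine Finset.sum_congr rfl fun y _ => ?_
    rcases isEmpty_or_nonempty 𝒳 with _ | ⟨⟨x⟩⟩
    · simp
    · exact h (x, y)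

theorem abs_sum_mul_le {ι : Type*} [Fintype ι] {u Q : ι → ℝ} {c : ℝ} (hu : ∀ z, |u z| ≤ c) :
    |∑ z, u z * Q z| ≤ c * ∑ z, |Q z| := by
  rw [Finset.mul_sum]
  refine (Finset.abs_sum_le_sum_abs _ _).trans (Finset.sum_le_sum fun z _ => ?_)
  rw [abs_mul]
  exact mul_le_mul_of_nonneg_right (hu z) (abs_nonneg _)

/-! ### Conditional means and debiasing -/

section Debias

variable {P : 𝒳 × 𝒴 → ℝ} (hP : ∀ z, 0 ≤ P z) (hP' : ∀ j z, 0 < fibreSum j P z)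

include hP hP' in
theorem abs_condMean_le (j : ℕ) {h : 𝒳 × 𝒴 → ℝ} {c : ℝ} (hh : ∀ z, |h z| ≤ c) (z : 𝒳 × 𝒴) :
    |condMean P j h z| ≤ c := by
  rw [condMean, abs_div, abs_of_pos (hP' j z), div_le_iff₀ (hP' j z), ← fibreSum_const_mul]
  refine (abs_fibreSum_le _ _ _).trans (fibreSum_mono _ (fun w => ?_) z)
  rw [abs_mul, abs_of_nonneg (hP w)]
  exact mul_le_mul_of_nonneg_right (hh w) (hP w)

include hP' in
theorem fibreSum_debias (j : ℕ) (h : 𝒳 × 𝒴 → ℝ) (z : 𝒳 × 𝒴) :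
    fibreSum j (fun w => debias P j h w * P w) z = 0 := by
  have : (fun w => debias P j h w * P w) = fun w => h w * P w - condMean P j h w * P w := by
    funext w
    rw [debias_apply]
    ring
  rw [this, fibreSum_sub, fibreSum_mul (isFibreConst_condMean P j h), condMean,
    div_mul_cancel₀ _ (hP' j z).ne', sub_self]

include hP' in
theorem condMean_debias (j : ℕ) (h : 𝒳 × 𝒴 → ℝ) (z : 𝒳 × 𝒴) :
    condMean P j (debias P j h) z = 0 := by
  rw [condMean, fibreSum_debias hP', zero_div]

theorem condMean_sub (P : 𝒳 × 𝒴 → ℝ) (j : ℕ) (g h : 𝒳 × 𝒴 → ℝ) (z : 𝒳 × 𝒴) :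
    condMean P j (fun w => g w - h w) z = condMean P j g z - condMean P j h z := by
  simp only [condMean, sub_mul, fibreSum_sub, sub_div]

/-- The bounds that pass from `g` to `debias P j g` along the iterated debiasing. -/
structure DebiasBound (P : 𝒳 × 𝒴 → ℝ) (H : ℝ) (j : ℕ) (a : ℝ) (g : 𝒳 × 𝒴 → ℝ) : Prop where
  bound : ∀ z, |g z| ≤ a
  condMean_self : ∀ z, |condMean P j g z| ≤ 2 * H
  condMean_next : ∀ z, |condMean P (j + 1) (debias P j g) z| ≤ 2 * H

include hP hP' in
theorem debiasBound_init {H : ℝ} (j : ℕ) {h : 𝒳 × 𝒴 → ℝ} (hh : ∀ z, |h z| ≤ H) :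
    DebiasBound P H j H h where
  bound := hh
  condMean_self z := by
    have := abs_condMean_le hP hP' j hh z
    linarith [abs_nonneg (condMean P j h z)]
  condMean_next := by
    refine abs_condMean_le hP hP' _ fun z => ?_
    rw [debias_apply]
    have := abs_condMean_le hP hP' j hh z
    linarith [abs_sub (h z) (condMean P j h z), hh z]

-- The sup norm grows by `2H` per step, where the triangle inequality alone would double it. The
-- reason is that `condMean P (j + 1)` annihilates the output of `debias P (j + 1)`, so after the
-- next debiasing only minus a conditional mean of a conditional mean survives, and the bound `2H`
-- passes through that contraction.
include hP hP' in
theorem DebiasBound.step {H a : ℝ} {j : ℕ} {g : 𝒳 × 𝒴 → ℝ} (hg : DebiasBound P H (j + 1) a g) :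
    DebiasBound P H j (a + 2 * H) (debias P (j + 1) g) where
  bound z := by
    rw [debias_apply]
    linarith [abs_sub (g z) (condMean P (j + 1) g z), hg.bound z, hg.condMean_self z]
  condMean_self z := by
    have := hg.condMean_next z
    rwa [show j + 1 + 1 = j + 2 from rfl, condMean_add_two] at this
  condMean_next z := by
    have h1 : debias P j (debias P (j + 1) g) =
        fun w => debias P (j + 1) g w - condMean P j (debias P (j + 1) g) w :=
      funext (debias_apply P j _)
    rw [h1, condMean_sub, condMean_debias hP', zero_sub, abs_neg]
    refine abs_condMean_le hP hP' _ (fun w => ?_) z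
    have := hg.condMean_next w
    rwa [show j + 1 + 1 = j + 2 from rfl, condMean_add_two] at this

include hP hP' in
theorem DebiasBound.abs_debiasIter_le {H : ℝ} {j : ℕ} {a : ℝ} {g : 𝒳 × 𝒴 → ℝ}
    (hg : DebiasBound P H j a g) (z : 𝒳 × 𝒴) : |debiasIter P j g z| ≤ a + 2 * H * j := by
  induction j generalizing a g with
  | zero => simpa [debiasIter] using hg.bound z
  | succ j ih =>
    have := ih (hg.step hP hP')
    rw [debiasIter]
    push_cast
    linarith

end Debias

/-! ### The balancing iterations -/

section Balance

variable {P' R : 𝒳 × 𝒴 → ℝ}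

/-- The factor of step `j + 1` of the balancing iterations with the marginals of `P'` as target. -/
noncomputable def scaling (P' R : 𝒳 × 𝒴 → ℝ) (j : ℕ) (z : 𝒳 × 𝒴) : ℝ :=
  fibreSum (j + 1) P' z / fibreSum (j + 1) (balance (marginX P') (marginY P') R j) z

theorem balance_succ (P' R : 𝒳 × 𝒴 → ℝ) (j : ℕ) (z : 𝒳 × 𝒴) :
    balance (marginX P') (marginY P') R (j + 1) z =
      scaling P' R j z * balance (marginX P') (marginY P') R j z := by
  rw [balance, scaling, fibreSum, fibreSum]
  split_ifs <;> rfl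

theorem isFibreConst_scaling (P' R : 𝒳 × 𝒴 → ℝ) (j : ℕ) :
    IsFibreConst (j + 1) (scaling P' R j) :=
  (isFibreConst_fibreSum _ _).comp₂ (isFibreConst_fibreSum _ _) (· / ·)

variable (hP' : ∀ j z, 0 < fibreSum j P' z) (hR : ∀ z, 0 ≤ R z) (hR' : ∀ j z, 0 < fibreSum j R z)

theorem fibreSum_pos_of_pos_mul {j : ℕ} {f Q : 𝒳 × 𝒴 → ℝ} (hf : ∀ z, 0 < f z)
    (hQ : ∀ z, 0 ≤ Q z) (z : 𝒳 × 𝒴) (h : 0 < fibreSum j Q z) :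
    0 < fibreSum j (fun w => f w * Q w) z := by
  unfold fibreSum at *
  split_ifs at *
  · obtain ⟨y, hy, hy'⟩ := Finset.exists_ne_zero_of_sum_ne_zero h.ne'
    exact Finset.sum_pos' (fun y _ => mul_nonneg (hf _).le (hQ _))
      ⟨y, hy, mul_pos (hf _) (lt_of_le_of_ne (hQ _) hy'.symm)⟩
  · obtain ⟨y, hy, hy'⟩ := Finset.exists_ne_zero_of_sum_ne_zero h.ne'
    exact Finset.sum_pos' (fun y _ => mul_nonneg (hf _).le (hQ _))
      ⟨y, hy, mul_pos (hf _) (lt_of_le_of_ne (hQ _) hy'.symm)⟩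

include hP' hR hR' in
theorem balance_nonneg_and_fibreSum_pos (j : ℕ) :
    (∀ z, 0 ≤ balance (marginX P') (marginY P') R j z) ∧
      ∀ i z, 0 < fibreSum i (balance (marginX P') (marginY P') R j) z := by
  induction j with
  | zero => exact ⟨hR, hR'⟩
  | succ j ih =>
    have hs : ∀ z, 0 < scaling P' R j z := fun z => div_pos (hP' _ z) (ih.2 _ z)
    rw [funext (balance_succ P' R j)]
    exact ⟨fun z => mul_nonneg (hs z).le (ih.1 z),
      fun i z => fibreSum_pos_of_pos_mul hs ih.1 z (ih.2 i z)⟩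

include hP' hR hR' in
theorem fibreSum_balance_succ (j : ℕ) (z : 𝒳 × 𝒴) :
    fibreSum (j + 1) (balance (marginX P') (marginY P') R (j + 1)) z = fibreSum (j + 1) P' z := by
  rw [funext (balance_succ P' R j), fibreSum_mul (isFibreConst_scaling P' R j), scaling,
    div_mul_cancel₀ _ ((balance_nonneg_and_fibreSum_pos hP' hR hR' j).2 _ z).ne']

include hP' hR hR' in
theorem sum_balance (hsum : ∑ z, R z = ∑ z, P' z) (j : ℕ) :
    ∑ z, balance (marginX P') (marginY P') R j z = ∑ z, P' z := by
  cases j with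
  | zero => exact hsum
  | succ j => exact sum_eq_sum_of_fibreSum_eq (j + 1) (fibreSum_balance_succ hP' hR hR' j)

/-- The `j`-marginals of `Q` and `Q'` are within a factor `M` of each other. -/
def CloseFibres (j : ℕ) (M : ℝ) (Q Q' : 𝒳 × 𝒴 → ℝ) : Prop :=
  ∀ z, fibreSum j Q z ≤ M * fibreSum j Q' z ∧ fibreSum j Q' z ≤ M * fibreSum j Q z

-- The step multiplies every mass by a factor in `[1/M, M]`, so it disturbs the marginal in the
-- other coordinate by at most a factor `M`.
include hP' hR hR' in
theorem closeFibres_step {j : ℕ} {M N : ℝ} (hM : 0 < M)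
    (h1 : CloseFibres (j + 1) M P' (balance (marginX P') (marginY P') R j))
    (h2 : CloseFibres j N P' (balance (marginX P') (marginY P') R j)) :
    CloseFibres (j + 2) (M * N) P' (balance (marginX P') (marginY P') R (j + 1)) := by
  intro z
  obtain ⟨hn, hp⟩ := balance_nonneg_and_fibreSum_pos hP' hR hR' j
  rw [fibreSum_add_two, fibreSum_add_two]
  have hup : ∀ w, balance (marginX P') (marginY P') R (j + 1) w ≤
      M * balance (marginX P') (marginY P') R j w := fun w => by
    rw [balance_succ]
    refine mul_le_mul_of_nonneg_right ?_ (hn w)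
    rw [scaling, div_le_iff₀ (hp _ w)]
    exact (h1 w).1
  have hlo : ∀ w, balance (marginX P') (marginY P') R j w ≤
      M * balance (marginX P') (marginY P') R (j + 1) w := fun w => by
    rw [balance_succ, ← mul_assoc]
    refine le_mul_of_one_le_left (hn w) ?_
    rw [scaling, mul_div_assoc', one_le_div (hp _ w)]
    exact (h1 w).2
  have h3 := fibreSum_mono j hup z
  have h4 := fibreSum_mono j hlo z
  rw [fibreSum_const_mul] at h3 h4
  obtain ⟨h5, h6⟩ := h2 z
  constructor
  · rcases le_or_gt 0 N with hN | hN
    · calc _ ≤ _ := h5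
        _ ≤ _ := mul_le_mul_of_nonneg_left h4 hN
        _ = _ := by ring
    · have := hP' j z
      have := mul_neg_of_neg_of_pos hN (hp j z)
      linarith
  · calc _ ≤ _ := h3
      _ ≤ _ := mul_le_mul_of_nonneg_left h6 hM.le
      _ = _ := by ring

-- The ratio bound does not compound with `j`: the marginal just balanced is exact, so the next step
-- only inherits the size of the current scaling factor.
include hP' hR hR' in
theorem closeFibres_balance {M : ℝ} (hM : 1 ≤ M) (h0 : ∀ j, CloseFibres j M P' R) (j : ℕ) :
    CloseFibres (j + 1) (M * M) P' (balance (marginX P') (marginY P') R j) := by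
  induction j with
  | zero =>
    intro z
    obtain ⟨h1, h2⟩ := h0 1 z
    have h3 := hP' 1 z
    have h4 := hR' 1 z
    constructor
    · exact h1.trans (mul_le_mul_of_nonneg_right (by nlinarith) h4.le)
    · exact h2.trans (mul_le_mul_of_nonneg_right (by nlinarith) h3.le)
  | succ j ih =>
    cases j with
    | zero => exact closeFibres_step hP' hR hR' (by linarith) (h0 1) (h0 0)
    | succ j =>
      -- The preceding step made this marginal exact, so `closeFibres_step` applies with `N = 1`.
      rw [← mul_one (M * M)]
      refine closeFibres_step hP' hR hR' (by nlinarith) ih fun z => ?_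
      rw [fibreSum_balance_succ hP' hR hR', one_mul]
      exact ⟨le_rfl, le_rfl⟩

include hP' hR hR' in
theorem abs_scaling_sub_one_le {M : ℝ} (hM : 1 ≤ M) (h0 : ∀ j, CloseFibres j M P' R) (j : ℕ)
    (z : 𝒳 × 𝒴) : |scaling P' R j z - 1| ≤ M * M - 1 := by
  obtain ⟨h1, h2⟩ := closeFibres_balance hP' hR hR' hM h0 j z
  have hp := (balance_nonneg_and_fibreSum_pos hP' hR hR' j).2 (j + 1) z
  rw [← div_le_iff₀ hp] at h1
  rw [← one_le_div hp, mul_div_assoc] at h2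
  change scaling P' R j z ≤ _ at h1
  change 1 ≤ M * M * scaling P' R j z at h2
  have h3 : 1 ≤ M * M := by nlinarith
  rw [abs_le]
  constructor
  · nlinarith [sq_nonneg (M * M - 1)]
  · linarith

-- Every iterate has total mass one, so a step whose factors are within `s` of one moves it by at
-- most `s` in ℓ¹.
include hP' hR hR' in
theorem sum_abs_balance_sub_le {s : ℝ} (hR1 : ∑ z, R z = 1) (hP1 : ∑ z, P' z = 1)
    (hs : ∀ j z, |scaling P' R j z - 1| ≤ s) (P : 𝒳 × 𝒴 → ℝ) (j : ℕ) :
    ∑ z, |balance (marginX P') (marginY P') R j z - P z| ≤ ∑ z, |R z - P z| + j * s := by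
  induction j with
  | zero => simp [balance]
  | succ j ih =>
    have h1 : ∑ z, |balance (marginX P') (marginY P') R (j + 1) z - P z| ≤
        ∑ z, (s * balance (marginX P') (marginY P') R j z +
          |balance (marginX P') (marginY P') R j z - P z|) := by
      refine Finset.sum_le_sum fun z _ => ?_
      have hn := (balance_nonneg_and_fibreSum_pos hP' hR hR' j).1 z
      have h2 : balance (marginX P') (marginY P') R (j + 1) z - P z =
          (scaling P' R j z - 1) * balance (marginX P') (marginY P') R j z +
            (balance (marginX P') (marginY P') R j z - P z) := by
        rw [balance_succ]
        ring
      rw [h2]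
      refine (abs_add_le _ _).trans (add_le_add_left ?_ _)
      rw [abs_mul, abs_of_nonneg hn]
      exact mul_le_mul_of_nonneg_right (hs j z) hn
    rw [Finset.sum_add_distrib, ← Finset.mul_sum,
      sum_balance hP' hR hR' (hR1.trans hP1.symm), hP1] at h1
    push_cast
    linarith

end Balance

/-! ### The error of the balanced estimator -/

section Error

variable {P P' R : 𝒳 × 𝒴 → ℝ} (hP : ∀ z, 0 ≤ P z) (hPpos : ∀ j z, 0 < fibreSum j P z)
  (hP' : ∀ j z, 0 < fibreSum j P' z) (hR : ∀ z, 0 ≤ R z) (hR' : ∀ j z, 0 < fibreSum j R z)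

theorem expect_sub_expect (Q P g : 𝒳 × 𝒴 → ℝ) :
    expect Q g - expect P g = ∑ z, g z * (Q z - P z) := by
  simp only [expect, ← Finset.sum_sub_distrib, mul_sub]

include hPpos hP' hR hR' in
/-- One step of the error recursion. -/
theorem expect_balance_succ_sub (j : ℕ) (g : 𝒳 × 𝒴 → ℝ) :
    expect (balance (marginX P') (marginY P') R (j + 1)) g - expect P g =
      (expect (balance (marginX P') (marginY P') R j) (debias P (j + 1) g) -
        expect P (debias P (j + 1) g)) +
      ∑ z, ((scaling P' R j z - 1) * debias P (j + 1) g z) *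
        (balance (marginX P') (marginY P') R j z - P z) +
      ∑ z, condMean P (j + 1) g z * (P' z - P z) := by
  have hu := isFibreConst_condMean P (j + 1) g
  have hd := fibreSum_debias (P := P) hPpos (j + 1) g
  -- The conditional mean only sees the marginal just balanced, which now equals that of `P'`.
  have h1 : ∑ z, condMean P (j + 1) g z * balance (marginX P') (marginY P') R (j + 1) z =
      ∑ z, condMean P (j + 1) g z * P' z := by
    refine sum_eq_sum_of_fibreSum_eq (j + 1) fun z => ?_
    rw [fibreSum_mul hu, fibreSum_mul hu, fibreSum_balance_succ hP' hR hR']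
  -- The scaling is constant on fibres, and the debiased function has `P`-mean zero on each fibre.
  -- Hence `P` can be subtracted from the iterate next to the factor, which makes the cross term
  -- second order.
  have h2 : ∑ z, scaling P' R j z * (debias P (j + 1) g z * P z) = ∑ _z : 𝒳 × 𝒴, (0 : ℝ) := by
    refine sum_eq_sum_of_fibreSum_eq (j + 1) fun z => ?_
    rw [fibreSum_mul (isFibreConst_scaling P' R j), hd]
    simp [fibreSum, marginX, marginY]
  rw [Finset.sum_const_zero] at h2
  have key : ∀ z, g z * (balance (marginX P') (marginY P') R (j + 1) z - P z) =
      debias P (j + 1) g z * (balance (marginX P') (marginY P') R j z - P z) +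
      (scaling P' R j z - 1) * debias P (j + 1) g z *
        (balance (marginX P') (marginY P') R j z - P z) +
      condMean P (j + 1) g z * (P' z - P z) +
      (condMean P (j + 1) g z * balance (marginX P') (marginY P') R (j + 1) z -
        condMean P (j + 1) g z * P' z) +
      scaling P' R j z * (debias P (j + 1) g z * P z) - debias P (j + 1) g z * P z := by
    intro z
    rw [balance_succ, debias_apply]
    ring
  have h3 : ∑ z, debias P (j + 1) g z * P z = ∑ _z : 𝒳 × 𝒴, (0 : ℝ) :=
    sum_eq_sum_of_fibreSum_eq (j + 1) fun z => by
      rw [hd]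
      simp [fibreSum, marginX, marginY]
  rw [Finset.sum_const_zero] at h3
  rw [expect_sub_expect, expect_sub_expect]
  simp only [key, Finset.sum_sub_distrib, Finset.sum_add_distrib, h1, h2, h3]
  ring

include hP hPpos hP' hR hR' in
theorem abs_error_sub_le {H r D ε : ℝ} (hH : 0 ≤ H) (hr : 0 ≤ r)
    (hs : ∀ j z, |scaling P' R j z - 1| ≤ r) (hε : ∑ z, |P' z - P z| ≤ 2 * ε) {k : ℕ}
    (hD : ∀ j < k, ∑ z, |balance (marginX P') (marginY P') R j z - P z| ≤ D)
    {a : ℝ} {g : 𝒳 × 𝒴 → ℝ} (ha : 0 ≤ a) (hg : DebiasBound P H k a g) :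
    |(expect (balance (marginX P') (marginY P') R k) g - expect P g) -
      (expect R (debiasIter P k g) - expect P (debiasIter P k g))| ≤
      k * (r * (a + 2 * H * k) * D + 4 * H * ε) := by
  induction k generalizing a g with
  | zero => simp [balance, debiasIter]
  | succ j ih =>
    have hg' := hg.step hP hPpos
    have h1 := ih (fun i hi => hD i (hi.trans (Nat.lt_succ_self j))) (by positivity) hg'
    have h2 : |∑ z, ((scaling P' R j z - 1) * debias P (j + 1) g z) *
        (balance (marginX P') (marginY P') R j z - P z)| ≤ r * (a + 2 * H * (j + 1)) * D := by
      refine (abs_sum_mul_le (c := r * (a + 2 * H * (j + 1))) fun z => ?_).trans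
        (mul_le_mul_of_nonneg_left (hD j (Nat.lt_succ_self j)) (by positivity))
      rw [abs_mul]
      refine mul_le_mul (hs j z) ((hg'.bound z).trans ?_) (abs_nonneg _) hr
      have : 0 ≤ H * j := by positivity
      linarith
    have h3 : |∑ z, condMean P (j + 1) g z * (P' z - P z)| ≤ 4 * H * ε := by
      refine (abs_sum_mul_le hg.condMean_self).trans ?_
      nlinarith
    rw [expect_balance_succ_sub hPpos hP' hR hR', debiasIter]
    rw [abs_le] at *
    push_cast at *
    constructor <;> linarith [h1.1, h1.2, h2.1, h2.2, h3.1, h3.2]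

end Error

/-! ### The remainder rate and the pointwise bound on the squared error -/

theorem abs_expect_le {Q h : 𝒳 × 𝒴 → ℝ} {H : ℝ} (hQ : ∀ z, 0 ≤ Q z) (hQ1 : ∑ z, Q z = 1)
    (hh : ∀ z, |h z| ≤ H) : |expect Q h| ≤ H := by
  refine (abs_sum_mul_le hh).trans ?_
  simp [abs_of_nonneg (hQ _), hQ1]

theorem sq_expect_sub_expect_le {Q P h : 𝒳 × 𝒴 → ℝ} {H : ℝ} (hQ : ∀ z, 0 ≤ Q z)
    (hQ1 : ∑ z, Q z = 1) (hP : ∀ z, 0 ≤ P z) (hP1 : ∑ z, P z = 1) (hh : ∀ z, |h z| ≤ H) :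
    (expect Q h - expect P h) ^ 2 ≤ 4 * H ^ 2 := by
  have h1 := abs_le.1 (abs_expect_le hQ hQ1 hh)
  have h2 := abs_le.1 (abs_expect_le hP hP1 hh)
  have h3 : |expect Q h - expect P h| ≤ 2 * H := abs_le.2 ⟨by linarith, by linarith⟩
  calc _ = |expect Q h - expect P h| ^ 2 := (sq_abs _).symm
    _ ≤ (2 * H) ^ 2 := pow_le_pow_left₀ (abs_nonneg _) h3 2
    _ = _ := by ring

/-- The deterministic rate that bounds the remainder of the squared error: the sampling error
`k⁶ / (q⁴ n^{3/2})` and the contributions of a contamination `ε`, with `N = √n`. -/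
noncomputable def remainder (k : ℕ) (q ε N : ℝ) : ℝ :=
  k ^ 6 / (q ^ 4 * N ^ 3) + k ^ 6 * ε ^ 2 / q ^ 4 + k ^ 4 * ε / (q ^ 2 * N)

theorem remainder_nonneg (k : ℕ) {q ε N : ℝ} (hq : 0 < q) (hε : 0 ≤ ε) (hN : 1 ≤ N) :
    0 ≤ remainder k q ε N := by
  unfold remainder
  positivity

/-- This disposes of the regime where perturbation bounds fail. The thresholds are such that when
both alternatives fail, `t / N + 2 * ε ≤ q / 2`. The power `t ^ 4` is what cancels the `q ^ 4` in
the denominator. -/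
theorem one_le_mul_remainder {k : ℕ} {q ε N t : ℝ} (hk : 1 ≤ k) (hq : 0 < q) (hq1 : q ≤ 1)
    (hε : 0 ≤ ε) (hN : 1 ≤ N) (h : q / 8 < ε ∨ q / 4 < t / N) :
    1 ≤ 256 * (remainder k q ε N * (1 + t ^ 4)) := by
  have hk6 : (1 : ℝ) ≤ (k : ℝ) ^ 6 := one_le_pow₀ (by exact_mod_cast hk)
  have hN0 : 0 < N := by linarith
  have hR3 : 0 ≤ (k : ℝ) ^ 4 * ε / (q ^ 2 * N) := by positivity
  have ht : 0 ≤ t ^ 4 := by positivity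
  rcases h with h | h
  · have h1 : 1 / 64 ≤ (k : ℝ) ^ 6 * ε ^ 2 / q ^ 4 := by
      rw [div_le_div_iff₀ (by norm_num) (by positivity)]
      have h2 : q ^ 2 ≤ 64 * ε ^ 2 := by nlinarith
      have h3 : q ^ 4 ≤ q ^ 2 := pow_le_pow_of_le_one hq.le hq1 (by norm_num)
      nlinarith [sq_nonneg ε]
    have h2 : 0 ≤ (k : ℝ) ^ 6 / (q ^ 4 * N ^ 3) := by positivity
    have h3 : 1 / 64 ≤ remainder k q ε N := by
      unfold remainder
      linarith
    nlinarith
  · have h1 : 1 ≤ 256 * ((k : ℝ) ^ 6 / (q ^ 4 * N ^ 3) * t ^ 4) := by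
      have h2 : (q * N) ^ 4 ≤ (4 * t) ^ 4 := by
        rw [lt_div_iff₀ hN0] at h
        exact pow_le_pow_left₀ (by positivity) (by linarith) 4
      rw [div_mul_eq_mul_div, mul_div_assoc', one_le_div (by positivity)]
      have h3 : N ^ 3 ≤ N ^ 4 := pow_le_pow_right₀ hN (by norm_num)
      calc q ^ 4 * N ^ 3 ≤ q ^ 4 * N ^ 4 := mul_le_mul_of_nonneg_left h3 (by positivity)
        _ = (q * N) ^ 4 := by ring
        _ ≤ (4 * t) ^ 4 := h2
        _ = 256 * (1 * t ^ 4) := by ring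
        _ ≤ _ := by gcongr
    have h2 : 0 ≤ (k : ℝ) ^ 6 * ε ^ 2 / q ^ 4 := by positivity
    have h4 : (k : ℝ) ^ 6 / (q ^ 4 * N ^ 3) ≤ remainder k q ε N := by
      unfold remainder
      linarith
    have h5 := mul_le_mul_of_nonneg_right h4 ht
    have h6 := remainder_nonneg k hq hε hN
    nlinarith

/-- The second-order terms of the squared error are dominated by `remainder`. -/
theorem second_order_le_remainder {k : ℕ} {q ε N t : ℝ} (hk : 1 ≤ k) (hq : 0 < q) (hq1 : q ≤ 1)
    (hε : 0 ≤ ε) (hε1 : ε ≤ 1) (hN : 1 ≤ N) (ht : 0 ≤ t) :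
    2 * (3 * k * (t / N)) * (36 * k ^ 3 * (2 * (t / N + 2 * ε) / q) ^ 2 + 4 * k * ε) +
      (36 * k ^ 3 * (2 * (t / N + 2 * ε) / q) ^ 2 + 4 * k * ε) ^ 2 ≤
      10000000 * (remainder k q ε N * (1 + t ^ 4)) := by
  have hk1 : (1 : ℝ) ≤ k := by exact_mod_cast hk
  have hN0 : 0 < N := by linarith
  have hT1 : (1 : ℝ) ≤ 1 + t ^ 4 := by
    have : 0 ≤ t ^ 4 := by positivity
    linarith
  have hT4 : t ^ 4 ≤ 1 + t ^ 4 := by linarith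
  have hTt : t ≤ 1 + t ^ 4 := by
    nlinarith [sq_nonneg (t ^ 2 - 1 / 2), sq_nonneg (t - 1 / 2)]
  have hT3 : t ^ 3 ≤ 1 + t ^ 4 := by
    nlinarith [mul_nonneg (sq_nonneg t) (sq_nonneg (t - 1)), sq_nonneg (t ^ 2 - 1)]
  generalize hT : 1 + t ^ 4 = T at *
  have hT0 : 0 < T := by linarith
  have hq2 : q ^ 4 ≤ q ^ 2 := pow_le_pow_of_le_one hq.le hq1 (by norm_num)
  have hq4 : q ^ 4 ≤ 1 := pow_le_one₀ hq.le hq1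
  have hq21 : q ^ 2 ≤ 1 := pow_le_one₀ hq.le hq1
  have hk24 : (k : ℝ) ^ 2 ≤ k ^ 4 := pow_le_pow_right₀ hk1 (by norm_num)
  have hk26 : (k : ℝ) ^ 2 ≤ k ^ 6 := pow_le_pow_right₀ hk1 (by norm_num)
  have hk46 : (k : ℝ) ^ 4 ≤ k ^ 6 := pow_le_pow_right₀ hk1 (by norm_num)
  have hN34 : N ^ 3 ≤ N ^ 4 := pow_le_pow_right₀ hN (by norm_num)
  have hε2 : ε ^ 2 ≤ ε := by nlinarith
  have hε4 : ε ^ 4 ≤ ε ^ 2 := pow_le_pow_of_le_one hε hε1 (by norm_num)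
  -- `F1` to `F6` charge each monomial of the expanded left side to one of the three terms of
  -- `remainder`, times `T`.
  have F1 : k ^ 4 * (t / N) ^ 3 / q ^ 2 ≤ k ^ 6 / (q ^ 4 * N ^ 3) * T :=
    calc k ^ 4 * (t / N) ^ 3 / q ^ 2 = k ^ 4 / (q ^ 2 * N ^ 3) * t ^ 3 := by field_simp
      _ ≤ _ := by gcongr
  have F2 : k ^ 4 * ((t / N) * ε ^ 2) / q ^ 2 ≤ k ^ 4 * ε / (q ^ 2 * N) * T :=
    calc k ^ 4 * ((t / N) * ε ^ 2) / q ^ 2 = k ^ 4 * ε ^ 2 / (q ^ 2 * N) * t := by field_simp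
      _ ≤ _ := by gcongr
  have F3 : k ^ 2 * ((t / N) * ε) ≤ k ^ 4 * ε / (q ^ 2 * N) * T :=
    calc k ^ 2 * ((t / N) * ε) = k ^ 2 * ε / (1 * N) * t := by field_simp
      _ ≤ _ := by gcongr
  have F4 : k ^ 6 * (t / N) ^ 4 / q ^ 4 ≤ k ^ 6 / (q ^ 4 * N ^ 3) * T :=
    calc k ^ 6 * (t / N) ^ 4 / q ^ 4 = k ^ 6 / (q ^ 4 * N ^ 4) * t ^ 4 := by field_simp
      _ ≤ _ := by gcongr
  have F5 : k ^ 6 * ε ^ 4 / q ^ 4 ≤ k ^ 6 * ε ^ 2 / q ^ 4 * T :=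
    calc k ^ 6 * ε ^ 4 / q ^ 4 ≤ k ^ 6 * ε ^ 2 / q ^ 4 * 1 := by rw [mul_one]; gcongr
      _ ≤ _ := by gcongr
  have F6 : k ^ 2 * ε ^ 2 ≤ k ^ 6 * ε ^ 2 / q ^ 4 * T :=
    calc k ^ 2 * ε ^ 2 = k ^ 2 * ε ^ 2 / 1 * 1 := by ring
      _ ≤ _ := by gcongr
  have hA : 0 ≤ k ^ 6 / (q ^ 4 * N ^ 3) * T := by positivity
  have hB : 0 ≤ k ^ 6 * ε ^ 2 / q ^ 4 * T := by positivity
  have hC : 0 ≤ k ^ 4 * ε / (q ^ 2 * N) * T := by positivity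
  have hη : 0 ≤ t / N := by positivity
  generalize t / N = η at *
  have hs2 : (2 * (η + 2 * ε) / q) ^ 2 ≤ (8 * η ^ 2 + 32 * ε ^ 2) / q ^ 2 := by
    rw [div_pow]
    gcongr
    nlinarith [sq_nonneg (η - 2 * ε)]
  have hs4 : ((2 * (η + 2 * ε) / q) ^ 2) ^ 2 ≤ (128 * η ^ 4 + 2048 * ε ^ 4) / q ^ 4 :=
    calc _ ≤ ((8 * η ^ 2 + 32 * ε ^ 2) / q ^ 2) ^ 2 := by gcongr
      _ = (8 * η ^ 2 + 32 * ε ^ 2) ^ 2 / q ^ 4 := by rw [div_pow]; ring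
      _ ≤ _ := by
        gcongr
        nlinarith [sq_nonneg (8 * η ^ 2 - 32 * ε ^ 2)]
  generalize (2 * (η + 2 * ε) / q) ^ 2 = S at *
  have G1 : k ^ 4 * η * S ≤ 8 * (k ^ 4 * η ^ 3 / q ^ 2) + 32 * (k ^ 4 * (η * ε ^ 2) / q ^ 2) :=
    calc _ ≤ k ^ 4 * η * ((8 * η ^ 2 + 32 * ε ^ 2) / q ^ 2) := by gcongr
      _ = _ := by ring
  have G2 : k ^ 6 * S ^ 2 ≤ 128 * (k ^ 6 * η ^ 4 / q ^ 4) + 2048 * (k ^ 6 * ε ^ 4 / q ^ 4) :=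
    calc _ ≤ k ^ 6 * ((128 * η ^ 4 + 2048 * ε ^ 4) / q ^ 4) := by gcongr
      _ = _ := by ring
  have G3 : 2 * (3 * k * η) * (36 * k ^ 3 * S + 4 * k * ε) + (36 * k ^ 3 * S + 4 * k * ε) ^ 2 ≤
      216 * (k ^ 4 * η * S) + 24 * (k ^ 2 * (η * ε)) + 2592 * (k ^ 6 * S ^ 2) +
        32 * (k ^ 2 * ε ^ 2) := by
    nlinarith [sq_nonneg (36 * (k : ℝ) ^ 3 * S - 4 * k * ε)]
  -- The largest coefficient collected is about `2592 * 2048`, from `F5`; this fixes the constant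
  -- `10000000`.
  unfold remainder
  linarith

/-- Pointwise bound on the squared error of the balanced estimator: up to second-order terms it
is the squared error of the empirical mean of the debiased function. -/
theorem sq_error_le {P P' R : 𝒳 × 𝒴 → ℝ} (hP : P ∈ stdSimplex ℝ (𝒳 × 𝒴))
    (hP' : P' ∈ stdSimplex ℝ (𝒳 × 𝒴)) (hR : R ∈ stdSimplex ℝ (𝒳 × 𝒴))
    (hPpos : ∀ j z, 0 < fibreSum j P z) {q ε N t H : ℝ} (hq : 0 < q) (hq1 : q ≤ 1)
    (hqP' : ∀ j z, q ≤ fibreSum j P' z) (hε : 0 ≤ ε) (hε1 : ε ≤ 1)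
    (hPP' : ∑ z, |P' z - P z| ≤ 2 * ε) (hN : 1 ≤ N) (hRP : ∑ z, |R z - P z| = t / N)
    {h : 𝒳 × 𝒴 → ℝ} (hh : ∀ z, |h z| ≤ H) (hH : 0 ≤ H) {k : ℕ} (hk : 1 ≤ k)
    (hRpos : ∀ j z, 0 < fibreSum j R z) :
    (expect (balance (marginX P') (marginY P') R k) h - expect P h) ^ 2 ≤
      (expect R (debiasIter P k h) - expect P (debiasIter P k h)) ^ 2 +
        10000000 * H ^ 2 * (remainder k q ε N * (1 + t ^ 4)) := by
  have hN0 : 0 < N := by linarith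
  have hη : 0 ≤ t / N := hRP ▸ Finset.sum_nonneg fun _ _ => abs_nonneg _
  have ht : 0 ≤ t := by
    have := mul_nonneg hη hN0.le
    rwa [div_mul_cancel₀ _ hN0.ne'] at this
  have hP'pos : ∀ j z, 0 < fibreSum j P' z := fun j z => hq.trans_le (hqP' j z)
  by_cases hbig : q / 8 < ε ∨ q / 4 < t / N
  · have h1 := one_le_mul_remainder hk hq hq1 hε hN hbig
    have h2 := sq_expect_sub_expect_le (H := H)
      (balance_nonneg_and_fibreSum_pos hP'pos hR.1 hRpos k).1
      ((sum_balance hP'pos hR.1 hRpos (hR.2.trans hP'.2.symm) k).trans hP'.2) hP.1 hP.2 hh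
    have h3 := mul_le_mul_of_nonneg_left h1 (sq_nonneg H)
    nlinarith [sq_nonneg (expect R (debiasIter P k h) - expect P (debiasIter P k h)), sq_nonneg H]
  rw [not_or, not_lt, not_lt] at hbig
  have hk1 : (1 : ℝ) ≤ k := by exact_mod_cast hk
  have hRP' : ∑ z, |R z - P' z| ≤ t / N + 2 * ε := by
    rw [← hRP]
    refine le_trans ?_ (add_le_add_right hPP' _)
    rw [← Finset.sum_add_distrib]
    exact Finset.sum_le_sum fun z _ => by
      rw [abs_sub_comm (P' z)]
      exact abs_sub_le _ _ _
  obtain ⟨s, hs⟩ : ∃ s, 2 * (t / N + 2 * ε) / q = s := ⟨_, rfl⟩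
  have hsq : s * q = 2 * (t / N + 2 * ε) := by rw [← hs, div_mul_cancel₀ _ hq.ne']
  have hs0 : 0 ≤ s := by rw [← hs]; positivity
  have hs1 : s ≤ 1 := by rw [← hs, div_le_one hq]; linarith
  have hηs : t / N ≤ s := by nlinarith
  -- Fibre sums of `R` and `P'` differ by at most `s * q / 2`, and those of `P'` are at least `q`;
  -- with `s ≤ 1` this gives the ratio `1 + s` both ways.
  have hclose : ∀ j, CloseFibres j (1 + s) P' R := fun j z => by
    have h1 : |fibreSum j R z - fibreSum j P' z| ≤ t / N + 2 * ε := by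
      rw [← fibreSum_sub]
      exact (abs_fibreSum_le _ _ _).trans
        ((fibreSum_le_sum j (fun _ => abs_nonneg _) z).trans hRP')
    have h2 := abs_le.1 h1
    have h3 := hqP' j z
    constructor <;> nlinarith
  have hscal : ∀ j z, |scaling P' R j z - 1| ≤ 3 * s := fun j z =>
    (abs_scaling_sub_one_le hP'pos hR.1 hRpos (by linarith) hclose j z).trans (by nlinarith)
  have hD : ∀ j < k, ∑ z, |balance (marginX P') (marginY P') R j z - P z| ≤ 4 * k * s :=
    fun j hj => by
      have h1 := sum_abs_balance_sub_le hP'pos hR.1 hRpos hR.2 hP'.2 hscal P j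
      have h2 : (j : ℝ) ≤ k := by exact_mod_cast hj.le
      rw [hRP] at h1
      nlinarith
  have hinit := debiasBound_init hP.1 hPpos k hh
  have herr := abs_error_sub_le hP.1 hPpos hP'pos hR.1 hRpos hH (by positivity) hscal hPP' hD hH
    hinit
  have hT : |expect R (debiasIter P k h) - expect P (debiasIter P k h)| ≤
      H * (3 * k * (t / N)) := by
    rw [expect_sub_expect, ← hRP]
    refine (abs_sum_mul_le (hinit.abs_debiasIter_le hP.1 hPpos)).trans ?_
    rw [← mul_assoc]
    refine mul_le_mul_of_nonneg_right ?_ (Finset.sum_nonneg fun _ _ => abs_nonneg _)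
    nlinarith
  have hsec := second_order_le_remainder hk hq hq1 hε hε1 hN ht
  rw [hs] at hsec
  have herr' : |(expect (balance (marginX P') (marginY P') R k) h - expect P h) -
      (expect R (debiasIter P k h) - expect P (debiasIter P k h))| ≤
      H * (36 * k ^ 3 * s ^ 2 + 4 * k * ε) := by
    refine herr.trans ?_
    have h1 : (H + 2 * H * k) ≤ 3 * k * H := by nlinarith
    calc _ ≤ (k : ℝ) * (3 * s * (3 * k * H) * (4 * k * s) + 4 * H * ε) := by gcongr
      _ = _ := by ring
  generalize expect (balance (marginX P') (marginY P') R k) h - expect P h = e at *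
  generalize expect R (debiasIter P k h) - expect P (debiasIter P k h) = T at *
  -- Keeping `T ^ 2` with coefficient one preserves the sharp leading term `σ_k² / n`.
  have h1 : e ^ 2 = T ^ 2 + (2 * (T * (e - T)) + (e - T) ^ 2) := by ring
  have h2 : T * (e - T) ≤
      (H * (3 * k * (t / N))) * (H * (36 * k ^ 3 * s ^ 2 + 4 * k * ε)) := by
    refine (le_abs_self _).trans ?_
    rw [abs_mul]
    exact mul_le_mul hT herr' (abs_nonneg _) ((abs_nonneg _).trans hT)
  have h3 : (e - T) ^ 2 ≤ (H * (36 * k ^ 3 * s ^ 2 + 4 * k * ε)) ^ 2 := by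
    rw [← sq_abs (e - T)]
    exact pow_le_pow_left₀ (abs_nonneg _) herr' 2
  have h4 := mul_le_mul_of_nonneg_left hsec (sq_nonneg H)
  rw [h1]
  linarith

/-! ### The empirical measure -/

theorem expect_empirical {n : ℕ} (z : Fin n → 𝒳 × 𝒴) (g : 𝒳 × 𝒴 → ℝ) :
    expect (empirical z) g = (∑ i, g (z i)) / n := by
  classical
  simp only [expect, empirical, mul_div_assoc', ← Finset.sum_div, Finset.mul_sum]
  rw [Finset.sum_comm]
  congr 1
  refine Finset.sum_congr rfl fun i _ => ?_
  simp [Set.indicator_apply]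

theorem empirical_mem_stdSimplex {n : ℕ} (hn : 1 ≤ n) (z : Fin n → 𝒳 × 𝒴) :
    empirical z ∈ stdSimplex ℝ (𝒳 × 𝒴) := by
  constructor
  · intro w
    refine div_nonneg (Finset.sum_nonneg fun i _ => ?_) n.cast_nonneg
    exact Set.indicator_nonneg (fun _ _ => zero_le_one) _
  · have h := expect_empirical z (fun _ => 1)
    have hn' : (n : ℝ) ≠ 0 := by exact_mod_cast (by omega : n ≠ 0)
    simpa [expect, hn'] using h

/-! ### Moments of independent samples from a finite set -/

section Sample

variable {α Ω : Type*} [Fintype α] [MeasurableSpace α] [MeasurableSingletonClass α]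
  [MeasurableSpace Ω] {ρ : Measure Ω} [IsProbabilityMeasure ρ] {n : ℕ} {Z : Fin n → Ω → α}
  {P : α → ℝ}

theorem integrable_comp_sample (hZ : ∀ i, Measurable (Z i)) (F : (Fin n → α) → ℝ) :
    Integrable (fun ω => F fun i => Z i ω) ρ := by
  have hm : Measurable fun ω i => Z i ω := measurable_pi_lambda _ hZ
  obtain ⟨c, hc⟩ := (Set.finite_range fun v => ‖F v‖).bddAbove
  exact Integrable.of_bound (Measurable.of_discrete.comp hm).aestronglyMeasurable c
    (ae_of_all _ fun ω => hc ⟨_, rfl⟩)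

theorem integral_comp_sample {i : Fin n} (hZ : Measurable (Z i))
    (hP : ∀ z, ρ.real {ω | Z i ω = z} = P z) (g : α → ℝ) :
    ∫ ω, g (Z i ω) ∂ρ = ∑ z, g z * P z := by
  have := Measure.isProbabilityMeasure_map (μ := ρ) hZ.aemeasurable
  rw [← integral_map (f := g) hZ.aemeasurable Measurable.of_discrete.aestronglyMeasurable,
    integral_fintype Integrable.of_finite]
  refine Finset.sum_congr rfl fun z _ => ?_
  rw [map_measureReal_apply hZ (measurableSet_singleton z), smul_eq_mul, mul_comm, ← hP z]
  rfl

theorem integral_sum_sub_sq (hZ : ∀ i, Measurable (Z i)) (hind : iIndepFun Z ρ)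
    (hP : ∀ i z, ρ.real {ω | Z i ω = z} = P z) (g : α → ℝ) :
    ∫ ω, (∑ i, g (Z i ω) - n * ∑ z, g z * P z) ^ 2 ∂ρ =
      n * ∑ z, (g z - ∑ w, g w * P w) ^ 2 * P z := by
  have hg : ∀ i, Measurable fun ω => g (Z i ω) := fun i => Measurable.of_discrete.comp (hZ i)
  have hmean : ∀ i, ∫ ω, g (Z i ω) ∂ρ = ∑ z, g z * P z := fun i =>
    integral_comp_sample (hZ i) (hP i) g
  have hint : ∀ i, Integrable (fun ω => g (Z i ω)) ρ := fun i =>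
    integrable_comp_sample hZ fun v => g (v i)
  have hLp : ∀ i, MemLp (fun ω => g (Z i ω)) 2 ρ := fun i =>
    (memLp_two_iff_integrable_sq (hg i).aestronglyMeasurable).2
      (integrable_comp_sample hZ fun v => g (v i) ^ 2)
  have hvar := IndepFun.variance_sum (X := fun i ω => g (Z i ω)) (s := Finset.univ)
    (fun i _ => hLp i) fun i _ j _ hij =>
      (hind.indepFun hij).comp Measurable.of_discrete Measurable.of_discrete
  have hsum : (∑ i, fun ω => g (Z i ω)) = fun ω => ∑ i, g (Z i ω) := by
    funext ω
    simp
  rw [hsum, variance_eq_integral (Finset.measurable_sum _ fun i _ => hg i).aemeasurable,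
    integral_finsetSum _ fun i _ => hint i] at hvar
  simp only [hmean, Finset.sum_const, Finset.card_univ, Fintype.card_fin, nsmul_eq_mul] at hvar
  rw [hvar, Finset.sum_congr rfl fun i _ => variance_eq_integral (hg i).aemeasurable]
  simp only [hmean]
  rw [Finset.sum_congr rfl fun i _ => integral_comp_sample (hZ i) (hP i)
    fun z => (g z - ∑ w, g w * P w) ^ 2]
  simp

theorem pow_four_le_exp_add_exp {N : ℝ} (hN : 0 < N) (x : ℝ) :
    x ^ 4 ≤ 24 * N ^ 4 * (Real.exp (N⁻¹ * x) + Real.exp (-N⁻¹ * x)) := by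
  have h1 := Real.pow_div_factorial_le_exp _ (abs_nonneg (N⁻¹ * x)) 4
  have h2 : |N⁻¹ * x| ^ 4 = x ^ 4 / N ^ 4 := by
    rw [Even.pow_abs (by decide), mul_pow, inv_pow, inv_mul_eq_div]
  have h3 : Real.exp |N⁻¹ * x| ≤ Real.exp (N⁻¹ * x) + Real.exp (-N⁻¹ * x) := by
    rw [neg_mul]
    exact Real.exp_abs_le _
  have h4 := h1.trans h3
  rw [h2, div_div, div_le_iff₀ (by positivity)] at h4
  simp only [Nat.factorial] at h4
  push_cast at h4
  linarith

/-- The fourth moment of a centred sum of `n` independent variables in `[0, 1]` is `O(n²)`. -/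
theorem integral_sum_sub_pow_four_le (hn : 1 ≤ n) (hZ : ∀ i, Measurable (Z i))
    (hind : iIndepFun Z ρ) (hP : ∀ i z, ρ.real {ω | Z i ω = z} = P z) {g : α → ℝ}
    (hg : ∀ z, g z ∈ Set.Icc (0 : ℝ) 1) :
    ∫ ω, (∑ i, g (Z i ω) - n * ∑ z, g z * P z) ^ 4 ∂ρ ≤ 144 * (n : ℝ) ^ 2 := by
  have hn0 : (0 : ℝ) < n := by exact_mod_cast hn
  have hN : 0 < √(n : ℝ) := Real.sqrt_pos.2 hn0
  have hN4 : √(n : ℝ) ^ 4 = (n : ℝ) ^ 2 := by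
    rw [show (4 : ℕ) = 2 * 2 from rfl, pow_mul, Real.sq_sqrt hn0.le]
  have hm : ∀ i, Measurable fun ω => g (Z i ω) := fun i => Measurable.of_discrete.comp (hZ i)
  have hsub : HasSubgaussianMGF (fun ω => ∑ i, (g (Z i ω) - ∑ z, g z * P z))
      (∑ _i : Fin n, (‖(1 : ℝ) - 0‖₊ / 2) ^ 2) ρ := by
    refine HasSubgaussianMGF.sum_of_iIndepFun
      (X := fun i ω => g (Z i ω) - ∑ z, g z * P z) ?_ fun i _ => ?_
    · exact hind.comp (fun _ z => g z - ∑ z, g z * P z) fun _ => Measurable.of_discrete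
    · rw [← integral_comp_sample (hZ i) (hP i) g]
      exact hasSubgaussianMGF_of_mem_Icc (hm i).aemeasurable (ae_of_all _ fun ω => hg _)
  have hsum : ∀ ω, ∑ i, (g (Z i ω) - ∑ z, g z * P z) =
      ∑ i, g (Z i ω) - n * ∑ z, g z * P z := fun ω => by simp
  simp only [hsum] at hsub
  have hmgf : ∀ t : ℝ, t ^ 2 * n = 1 →
      ∫ ω, Real.exp (t * (∑ i, g (Z i ω) - n * ∑ z, g z * P z)) ∂ρ ≤ 3 := fun t ht => by
    refine (hsub.mgf_le t).trans ?_
    have h1 : (((∑ _i : Fin n, (‖(1 : ℝ) - 0‖₊ / 2) ^ 2 : NNReal) : NNReal) : ℝ) = n / 4 := by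
      simp
      ring
    rw [h1, show (n / 4 * t ^ 2 / 2 : ℝ) = t ^ 2 * n / 8 by ring, ht]
    calc Real.exp (1 / 8) ≤ Real.exp 1 := Real.exp_le_exp.2 (by norm_num)
      _ ≤ 3 := by linarith [Real.exp_one_lt_d9]
  -- The variance proxy is `n / 4`, so at `±1/√n` the exponent is `1/8`. The bound `3` for each sign
  -- then gives `24 * (3 + 3) = 144`.
  have h1 := hmgf (√(n : ℝ))⁻¹ (by rw [inv_pow, Real.sq_sqrt hn0.le, inv_mul_cancel₀ hn0.ne'])
  have h2 := hmgf (-(√(n : ℝ))⁻¹)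
    (by rw [neg_sq, inv_pow, Real.sq_sqrt hn0.le, inv_mul_cancel₀ hn0.ne'])
  have hi := hsub.integrable_exp_mul
  calc _ ≤ ∫ ω, 24 * √(n : ℝ) ^ 4 *
        (Real.exp ((√(n : ℝ))⁻¹ * (∑ i, g (Z i ω) - n * ∑ z, g z * P z)) +
          Real.exp (-(√(n : ℝ))⁻¹ * (∑ i, g (Z i ω) - n * ∑ z, g z * P z))) ∂ρ :=
        integral_mono
          (integrable_comp_sample hZ fun v => (∑ i, g (v i) - n * ∑ z, g z * P z) ^ 4)
          (((hi _).add (hi _)).const_mul _) fun ω => pow_four_le_exp_add_exp hN _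
    _ ≤ 24 * (n : ℝ) ^ 2 * (3 + 3) := by
        rw [integral_const_mul, integral_add (hi _) (hi _), hN4]
        gcongr
    _ = _ := by ring

end Sample

section Empirical

variable [MeasurableSpace 𝒳] [MeasurableSingletonClass 𝒳] [MeasurableSpace 𝒴]
  [MeasurableSingletonClass 𝒴] {Ω : Type*} [MeasurableSpace Ω] {ρ : Measure Ω}
  [IsProbabilityMeasure ρ] {n : ℕ} {Z : Fin n → Ω → 𝒳 × 𝒴} {P : 𝒳 × 𝒴 → ℝ}

theorem integral_sq_empirical_sub (hn : 1 ≤ n) (hZ : ∀ i, Measurable (Z i)) (hind : iIndepFun Z ρ)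
    (hP : ∀ i z, ρ.real {ω | Z i ω = z} = P z) (g : 𝒳 × 𝒴 → ℝ) :
    ∫ ω, (expect (empirical fun i => Z i ω) g - expect P g) ^ 2 ∂ρ = variance P g / n := by
  have hn0 : (n : ℝ) ≠ 0 := by exact_mod_cast (by omega : n ≠ 0)
  have h1 : ∀ ω, (expect (empirical fun i => Z i ω) g - expect P g) ^ 2 =
      ((n : ℝ) ^ 2)⁻¹ * (∑ i, g (Z i ω) - n * ∑ z, g z * P z) ^ 2 := fun ω => by
    rw [expect_empirical]
    unfold expect
    field_simp
  simp only [h1]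
  rw [integral_const_mul, integral_sum_sub_sq hZ hind hP, variance, expect]
  unfold expect
  field_simp

theorem integral_sum_abs_empirical_sub_pow_four_le (hn : 1 ≤ n) (hZ : ∀ i, Measurable (Z i))
    (hind : iIndepFun Z ρ) (hP : ∀ i z, ρ.real {ω | Z i ω = z} = P z) :
    ∫ ω, (√(n : ℝ) * ∑ z, |empirical (fun i => Z i ω) z - P z|) ^ 4 ∂ρ ≤
      144 * (Fintype.card (𝒳 × 𝒴) : ℝ) ^ 4 := by
  classical
  have hn0 : (0 : ℝ) < n := by exact_mod_cast hn
  have hN4 : √(n : ℝ) ^ 4 = (n : ℝ) ^ 2 := by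
    rw [show (4 : ℕ) = 2 * 2 from rfl, pow_mul, Real.sq_sqrt hn0.le]
  have hmass : ∀ (Q : 𝒳 × 𝒴 → ℝ) z, expect Q (Set.indicator {z} fun _ => 1) = Q z := fun Q z => by
    simp [expect, Set.indicator_apply]
  have hterm : ∀ z, ∫ ω, (empirical (fun i => Z i ω) z - P z) ^ 4 ∂ρ ≤ 144 / (n : ℝ) ^ 2 :=
    fun z => by
      have h1 := integral_sum_sub_pow_four_le (g := Set.indicator {z} fun _ => 1) hn hZ hind hP
        fun w => by
          by_cases hw : w = z <;> simp [hw]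
      have h2 : ∀ ω, (empirical (fun i => Z i ω) z - P z) ^ 4 = ((n : ℝ) ^ 4)⁻¹ *
          (∑ i, Set.indicator {z} (fun _ => (1 : ℝ)) (Z i ω) -
            n * ∑ w, Set.indicator {z} (fun _ => (1 : ℝ)) w * P w) ^ 4 := fun ω => by
        rw [show ∑ w, Set.indicator {z} (fun _ => (1 : ℝ)) w * P w = P z from hmass P z, empirical]
        field_simp
      simp only [h2]
      rw [integral_const_mul]
      calc _ ≤ ((n : ℝ) ^ 4)⁻¹ * (144 * (n : ℝ) ^ 2) := by gcongr
        _ = _ := by field_simp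
  have hint : ∀ z, Integrable (fun ω => (empirical (fun i => Z i ω) z - P z) ^ 4) ρ := fun z =>
    integrable_comp_sample hZ fun v => (empirical v z - P z) ^ 4
  have hpt : ∀ ω, (√(n : ℝ) * ∑ z, |empirical (fun i => Z i ω) z - P z|) ^ 4 ≤
      (n : ℝ) ^ 2 * ((Fintype.card (𝒳 × 𝒴) : ℝ) ^ 3 *
        ∑ z, (empirical (fun i => Z i ω) z - P z) ^ 4) := fun ω => by
    rw [mul_pow, hN4]
    refine mul_le_mul_of_nonneg_left ?_ (by positivity)
    -- The power mean inequality reduces the ℓ¹ norm to single cells; it costs the cube of the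
    -- number of cells.
    have h1 := pow_sum_le_card_mul_sum_pow (s := Finset.univ)
      (f := fun z => |empirical (fun i => Z i ω) z - P z|) (fun _ _ => abs_nonneg _) 3
    simpa [Even.pow_abs (show Even 4 by decide)] using h1
  calc _ ≤ ∫ ω, (n : ℝ) ^ 2 * ((Fintype.card (𝒳 × 𝒴) : ℝ) ^ 3 *
        ∑ z, (empirical (fun i => Z i ω) z - P z) ^ 4) ∂ρ :=
        integral_mono
          (integrable_comp_sample hZ fun v => (√(n : ℝ) * ∑ z, |empirical v z - P z|) ^ 4)
          (((integrable_finsetSum _ fun z _ => hint z).const_mul _).const_mul _) hpt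
    _ ≤ (n : ℝ) ^ 2 * ((Fintype.card (𝒳 × 𝒴) : ℝ) ^ 3 *
        ∑ _z : 𝒳 × 𝒴, 144 / (n : ℝ) ^ 2) := by
        rw [integral_const_mul, integral_const_mul, integral_finsetSum _ fun z _ => hint z]
        gcongr with z
        exact hterm z
    _ = _ := by
        rw [Finset.sum_const, Finset.card_univ, nsmul_eq_mul]
        field_simp

end Empirical

/-! ### The contaminated target marginals -/

theorem mixture_mem_stdSimplex {S : Type*} [Fintype S] {ε : ℝ} {p p' : S → ℝ} (hε : 0 ≤ ε)
    (hε1 : ε ≤ 1) (hp : p ∈ stdSimplex ℝ S) (hp' : p' ∈ stdSimplex ℝ S) :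
    mixture ε p p' ∈ stdSimplex ℝ S :=
  convex_stdSimplex ℝ S hp hp' (by linarith) hε (by ring)

theorem mul_mem_stdSimplex {p : 𝒳 → ℝ} {r : 𝒴 → ℝ} (hp : p ∈ stdSimplex ℝ 𝒳)
    (hr : r ∈ stdSimplex ℝ 𝒴) : (fun z : 𝒳 × 𝒴 => p z.1 * r z.2) ∈ stdSimplex ℝ (𝒳 × 𝒴) := by
  refine ⟨fun z => mul_nonneg (hp.1 _) (hr.1 _), ?_⟩
  rw [Fintype.sum_prod_type]
  simp [← Finset.mul_sum, hp.2, hr.2]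

omit [Fintype 𝒳] in
theorem marginX_mixture_mul (ε : ℝ) (P : 𝒳 × 𝒴 → ℝ) (p : 𝒳 → ℝ) {r : 𝒴 → ℝ}
    (hr : r ∈ stdSimplex ℝ 𝒴) :
    marginX (mixture ε P fun z => p z.1 * r z.2) = mixture ε (marginX P) p := by
  funext x
  simp [marginX, mixture, Finset.sum_add_distrib, ← Finset.mul_sum, hr.2]

omit [Fintype 𝒴] in
theorem marginY_mixture_mul (ε : ℝ) (P : 𝒳 × 𝒴 → ℝ) {p : 𝒳 → ℝ} (r : 𝒴 → ℝ)
    (hp : p ∈ stdSimplex ℝ 𝒳) :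
    marginY (mixture ε P fun z => p z.1 * r z.2) = mixture ε (marginY P) r := by
  funext y
  simp [marginY, mixture, Finset.sum_add_distrib, ← Finset.mul_sum, ← Finset.sum_mul, hp.2]

theorem sum_abs_mixture_sub_le {S : Type*} [Fintype S] {ε : ℝ} {p p' : S → ℝ} (hε : 0 ≤ ε)
    (hp : p ∈ stdSimplex ℝ S) (hp' : p' ∈ stdSimplex ℝ S) :
    ∑ s, |mixture ε p p' s - p s| ≤ 2 * ε := by
  have h : ∀ s, |mixture ε p p' s - p s| ≤ ε * (p' s + p s) := fun s => by
    rw [mixture, show (1 - ε) * p s + ε * p' s - p s = ε * (p' s - p s) by ring, abs_mul,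
      abs_of_nonneg hε]
    refine mul_le_mul_of_nonneg_left (abs_le.2 ⟨?_, ?_⟩) hε <;> linarith [hp.1 s, hp'.1 s]
  refine (Finset.sum_le_sum fun s _ => h s).trans_eq ?_
  rw [← Finset.mul_sum, Finset.sum_add_distrib, hp.2, hp'.2]
  ring

theorem minMass_pos [Nonempty 𝒳] [Nonempty 𝒴] {p : 𝒳 → ℝ} {r : 𝒴 → ℝ} (hp : ∀ x, 0 < p x)
    (hr : ∀ y, 0 < r y) : 0 < minMass p r := by
  obtain ⟨x, hx⟩ := exists_eq_ciInf_of_finite (f := p)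
  obtain ⟨y, hy⟩ := exists_eq_ciInf_of_finite (f := r)
  rw [minMass, ← hx, ← hy]
  exact lt_min (hp x) (hr y)

theorem minMass_le_fibreSum (P' : 𝒳 × 𝒴 → ℝ) (j : ℕ) (z : 𝒳 × 𝒴) :
    minMass (marginX P') (marginY P') ≤ fibreSum j P' z := by
  unfold fibreSum
  split_ifs
  · exact (min_le_left _ _).trans (ciInf_le (Set.finite_range _).bddBelow z.1)
  · exact (min_le_right _ _).trans (ciInf_le (Set.finite_range _).bddBelow z.2)

theorem sameSupports_of_fibreSum_pos [Nonempty 𝒳] [Nonempty 𝒴] {P Q : 𝒳 × 𝒴 → ℝ}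
    (hP : ∀ j z, 0 < fibreSum j P z) (hQ : ∀ j z, 0 < fibreSum j Q z) : SameSupports Q P := by
  obtain ⟨x₀⟩ := ‹Nonempty 𝒳›
  obtain ⟨y₀⟩ := ‹Nonempty 𝒴›
  constructor
  · ext x
    have h1 := hP 1 (x, y₀)
    have h2 := hQ 1 (x, y₀)
    simp_all [fibreSum]
  · ext y
    have h1 := hP 0 (x₀, y)
    have h2 := hQ 0 (x₀, y)
    simp_all [fibreSum]

theorem SameSupports.fibreSum_pos {P Q : 𝒳 × 𝒴 → ℝ} (h : SameSupports Q P)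
    (hP : ∀ j z, 0 < fibreSum j P z) (j : ℕ) (z : 𝒳 × 𝒴) : 0 < fibreSum j Q z := by
  have hj := hP j z
  unfold fibreSum at *
  split_ifs at *
  · exact (Set.ext_iff.1 h.1 z.1).2 hj
  · exact (Set.ext_iff.1 h.2 z.2).2 hj

/-- Off the event that the supports agree, the sampling error or the contamination is so large
that the remainder dominates. -/
theorem sq_error_le_of_not_sameSupports [Nonempty 𝒳] [Nonempty 𝒴] {P P' R : 𝒳 × 𝒴 → ℝ}
    (hP : P ∈ stdSimplex ℝ (𝒳 × 𝒴)) (hR : R ∈ stdSimplex ℝ (𝒳 × 𝒴))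
    (hPpos : ∀ j z, 0 < fibreSum j P z) {q ε N t H : ℝ} (hq : 0 < q) (hq1 : q ≤ 1)
    (hqP' : ∀ j z, q ≤ fibreSum j P' z) (hε : 0 ≤ ε)
    (hPP' : ∑ z, |P' z - P z| ≤ 2 * ε) (hN : 1 ≤ N) (hRP : ∑ z, |R z - P z| = t / N)
    {h : 𝒳 × 𝒴 → ℝ} (hh : ∀ z, |h z| ≤ H) {k : ℕ} (hk : 1 ≤ k) (hS : ¬ SameSupports R P) :
    (expect R h - expect P h) ^ 2 ≤
      (expect R (debiasIter P k h) - expect P (debiasIter P k h)) ^ 2 +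
        10000000 * H ^ 2 * (remainder k q ε N * (1 + t ^ 4)) := by
  have hbig : q / 8 < ε ∨ q / 4 < t / N := by
    by_contra! hc
    -- With both quantities small, every fibre sum of `R` is at least `q - q/4 - q/4 > 0`, so no
    -- support point is lost.
    refine hS (sameSupports_of_fibreSum_pos hPpos fun j z => ?_)
    have h1 : |fibreSum j P z - fibreSum j R z| ≤ t / N := by
      rw [← fibreSum_sub, ← hRP]
      refine (abs_fibreSum_le _ _ _).trans ((fibreSum_le_sum j (fun _ => abs_nonneg _) z).trans ?_)
      exact (Finset.sum_congr rfl fun w _ => abs_sub_comm _ _).le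
    have h2 : |fibreSum j P' z - fibreSum j P z| ≤ 2 * ε := by
      rw [← fibreSum_sub]
      exact (abs_fibreSum_le _ _ _).trans
        ((fibreSum_le_sum j (fun _ => abs_nonneg _) z).trans hPP')
    linarith [abs_le.1 h1, abs_le.1 h2, hqP' j z]
  have h1 := one_le_mul_remainder hk hq hq1 hε hN hbig
  have h2 := sq_expect_sub_expect_le hR.1 hR.2 hP.1 hP.2 hh
  have h3 := mul_le_mul_of_nonneg_left h1 (sq_nonneg H)
  nlinarith [sq_nonneg (expect R (debiasIter P k h) - expect P (debiasIter P k h)), sq_nonneg H]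

/-! ### Integration of the pointwise bound and comparison of rates -/

theorem mse_le [MeasurableSpace 𝒳] [MeasurableSingletonClass 𝒳] [MeasurableSpace 𝒴]
    [MeasurableSingletonClass 𝒴] {Ω : Type*} [MeasurableSpace Ω] {ρ : Measure Ω}
    [IsProbabilityMeasure ρ] {n : ℕ} (hn : 1 ≤ n) {Z : Fin n → Ω → 𝒳 × 𝒴}
    (hZ : ∀ i, Measurable (Z i)) (hind : iIndepFun Z ρ) {P P' : 𝒳 × 𝒴 → ℝ}
    (hZP : ∀ i z, ρ.real {ω | Z i ω = z} = P z) (hP : P ∈ stdSimplex ℝ (𝒳 × 𝒴))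
    (hP' : P' ∈ stdSimplex ℝ (𝒳 × 𝒴)) (hPpos : ∀ j z, 0 < fibreSum j P z) {q ε H : ℝ}
    (hq : 0 < q) (hqP' : ∀ j z, q ≤ fibreSum j P' z) (hε : 0 ≤ ε) (hε1 : ε ≤ 1)
    (hPP' : ∑ z, |P' z - P z| ≤ 2 * ε) {h : 𝒳 × 𝒴 → ℝ} (hh : ∀ z, |h z| ≤ H) {k : ℕ}
    (hk : 1 ≤ k) :
    mse ρ Z P h (marginX P') (marginY P') k ≤ sigmaSq P h k / n +
      10000000 * (1 + 144 * (Fintype.card (𝒳 × 𝒴) : ℝ) ^ 4) * H ^ 2 *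
        remainder k q ε (√(n : ℝ)) := by
  classical
  have hne : Nonempty (𝒳 × 𝒴) := by
    by_contra hc
    rw [not_nonempty_iff] at hc
    simpa using hP.2
  obtain ⟨⟨x₀, y₀⟩⟩ := hne
  have hX : Nonempty 𝒳 := ⟨x₀⟩
  have hY : Nonempty 𝒴 := ⟨y₀⟩
  have hH : 0 ≤ H := (abs_nonneg _).trans (hh (x₀, y₀))
  have hq1 : q ≤ 1 := (hqP' 0 (x₀, y₀)).trans ((fibreSum_le_sum 0 hP'.1 _).trans_eq hP'.2)
  have hN : 1 ≤ √(n : ℝ) := Real.one_le_sqrt.2 (by exact_mod_cast hn)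
  have hN0 : √(n : ℝ) ≠ 0 := by positivity
  let S : Set (Fin n → 𝒳 × 𝒴) := {v | SameSupports (empirical v) P}
  let F : (Fin n → 𝒳 × 𝒴) → ℝ := S.indicator fun v =>
    (expect (balance (marginX P') (marginY P') (empirical v) k) h - expect P h) ^ 2
  let G : (Fin n → 𝒳 × 𝒴) → ℝ := Sᶜ.indicator fun v => (expect (empirical v) h - expect P h) ^ 2
  let T : (Fin n → 𝒳 × 𝒴) → ℝ := fun v =>
    (expect (empirical v) (debiasIter P k h) - expect P (debiasIter P k h)) ^ 2
  let t : (Fin n → 𝒳 × 𝒴) → ℝ := fun v => √(n : ℝ) * ∑ z, |empirical v z - P z|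
  have hmse : mse ρ Z P h (marginX P') (marginY P') k =
      ∫ ω, F (fun i => Z i ω) ∂ρ + ∫ ω, G (fun i => Z i ω) ∂ρ := rfl
  have hpt : ∀ v, F v + G v ≤
      T v + 10000000 * H ^ 2 * remainder k q ε (√(n : ℝ)) * (1 + t v ^ 4) := fun v => by
    have hR := empirical_mem_stdSimplex hn v
    have ht : ∑ z, |empirical v z - P z| = t v / √(n : ℝ) := by
      rw [mul_div_cancel_left₀ _ hN0]
    rw [mul_assoc _ (remainder _ _ _ _)]
    by_cases hv : v ∈ S
    · have hG : G v = 0 := Set.indicator_of_notMem (Set.notMem_compl_iff.2 hv) _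
      have hF : F v = _ := Set.indicator_of_mem hv _
      rw [hF, hG, add_zero]
      exact sq_error_le hP hP' hR hPpos hq hq1 hqP' hε hε1 hPP' hN ht hh hH hk
        (SameSupports.fibreSum_pos hv hPpos)
    · have hF : F v = 0 := Set.indicator_of_notMem hv _
      have hG : G v = _ := Set.indicator_of_mem (show v ∈ Sᶜ from hv) _
      rw [hF, hG, zero_add]
      exact sq_error_le_of_not_sameSupports hP hR hPpos hq hq1 hqP' hε hPP' hN ht hh hk hv
  have hiF := integrable_comp_sample (ρ := ρ) hZ F
  have hiG := integrable_comp_sample (ρ := ρ) hZ G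
  have hiT := integrable_comp_sample (ρ := ρ) hZ T
  have hit := integrable_comp_sample (ρ := ρ) hZ fun v => t v ^ 4
  have hit' : Integrable (fun ω => 10000000 * H ^ 2 * remainder k q ε (√(n : ℝ)) *
      (1 + t (fun i => Z i ω) ^ 4)) ρ := ((integrable_const 1).add hit).const_mul _
  have hrem := remainder_nonneg k hq hε hN
  have hET : ∫ ω, T (fun i => Z i ω) ∂ρ = sigmaSq P h k / n :=
    integral_sq_empirical_sub hn hZ hind hZP _
  have hEt : ∫ ω, t (fun i => Z i ω) ^ 4 ∂ρ ≤ 144 * (Fintype.card (𝒳 × 𝒴) : ℝ) ^ 4 :=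
    integral_sum_abs_empirical_sub_pow_four_le hn hZ hind hZP
  rw [hmse, ← integral_add hiF hiG]
  calc _ ≤ ∫ ω, (T (fun i => Z i ω) + 10000000 * H ^ 2 * remainder k q ε (√(n : ℝ)) *
        (1 + t (fun i => Z i ω) ^ 4)) ∂ρ :=
        integral_mono (hiF.add hiG) (hiT.add hit')
          fun ω => hpt _
    _ = sigmaSq P h k / n + 10000000 * H ^ 2 * remainder k q ε (√(n : ℝ)) *
        (1 + ∫ ω, t (fun i => Z i ω) ^ 4 ∂ρ) := by
        rw [integral_add hiT hit', integral_const_mul,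
          integral_add (integrable_const 1) hit, hET]
        simp
    _ ≤ sigmaSq P h k / n + 10000000 * H ^ 2 * remainder k q ε (√(n : ℝ)) *
        (1 + 144 * (Fintype.card (𝒳 × 𝒴) : ℝ) ^ 4) := by gcongr
    _ = _ := by ring

/-- The rate in the theorem, with `L = log (1 / (1 - ε))`, dominates `remainder`. -/
theorem remainder_le {k n : ℕ} {q ε L D : ℝ} (hq : 0 < q) (hε : 0 ≤ ε) (hL : ε ≤ L)
    (hD : 0 ≤ D) :
    remainder k q ε (√(n : ℝ)) ≤ (k : ℝ) ^ 6 / (q ^ 4 * (n : ℝ) ^ (3 / 2 : ℝ)) +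
      ((k : ℝ) ^ 4 / q ^ 2 * (√(1 / n * L) + L) *
        ((k : ℝ) ^ 2 / q ^ 2 * (√(1 / n * L) + L + 1 / n) + 1 / √(n : ℝ))) + D := by
  have h1 : √(n : ℝ) ^ 3 = (n : ℝ) ^ (3 / 2 : ℝ) := by
    rw [Real.sqrt_eq_rpow, ← Real.rpow_mul_natCast n.cast_nonneg]
    norm_num
  have h2 : ε ≤ √(1 / n * L) + L := by linarith [Real.sqrt_nonneg (1 / n * L)]
  have h3 : ε ≤ √(1 / n * L) + L + 1 / n := by
    have : (0 : ℝ) ≤ 1 / n := by positivity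
    linarith
  have hL0 : 0 ≤ L := hε.trans hL
  have h4 : (k : ℝ) ^ 6 * ε ^ 2 / q ^ 4 + (k : ℝ) ^ 4 * ε / (q ^ 2 * √(n : ℝ)) ≤
      (k : ℝ) ^ 4 / q ^ 2 * (√(1 / n * L) + L) *
        ((k : ℝ) ^ 2 / q ^ 2 * (√(1 / n * L) + L + 1 / n) + 1 / √(n : ℝ)) :=
    -- The two contamination terms factor into the shape of the target, and both occurrences of `ε`
    -- are then enlarged.
    calc _ = (k : ℝ) ^ 4 / q ^ 2 * ε * ((k : ℝ) ^ 2 / q ^ 2 * ε + 1 / √(n : ℝ)) := by ring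
      _ ≤ _ := by gcongr
  unfold remainder
  rw [h1]
  linarith

end Balancing

theorem mainTheorem4 :
    ∃ C : ℝ, 0 < C ∧ ∃ a : ℕ, ∀ m : ℕ, ∃ K : ℝ, 0 < K ∧
      ∀ (𝒳 : Type*) (𝒴 : Type*) [Fintype 𝒳] [Fintype 𝒴]
        [MeasurableSpace 𝒳] [MeasurableSingletonClass 𝒳]
        [MeasurableSpace 𝒴] [MeasurableSingletonClass 𝒴],
        Fintype.card 𝒳 = m → Fintype.card 𝒴 = m →
      -- the data-generating distribution, with positive marginals
      ∀ P : 𝒳 × 𝒴 → ℝ, P ∈ stdSimplex ℝ (𝒳 × 𝒴) →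
        (∀ x, 0 < Balancing.marginX P x) → (∀ y, 0 < Balancing.marginY P y) →
      -- the contaminating marginals, with positive masses, and the level of contamination
      ∀ (QX : 𝒳 → ℝ) (QY : 𝒴 → ℝ), QX ∈ stdSimplex ℝ 𝒳 → QY ∈ stdSimplex ℝ 𝒴 →
        (∀ x, 0 < QX x) → (∀ y, 0 < QY y) →
      ∀ ε : ℝ, 0 ≤ ε → ε < 1 →
      -- the test function, the number of iterations and the sample size
      ∀ (h : 𝒳 × 𝒴 → ℝ) (k n : ℕ), 1 ≤ k → 1 ≤ n →
      -- an i.i.d. sample from `P`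
      ∀ (Ω : Type*) [MeasurableSpace Ω] (ρ : Measure Ω) [IsProbabilityMeasure ρ]
        (Z : Fin n → Ω → 𝒳 × 𝒴), (∀ i, Measurable (Z i)) → iIndepFun Z ρ →
        (∀ i z, ρ.real {ω | Z i ω = z} = P z) →
      let PXε : 𝒳 → ℝ := Balancing.mixture ε (Balancing.marginX P) QX
      let PYε : 𝒴 → ℝ := Balancing.mixture ε (Balancing.marginY P) QY
      let p : ℝ := Balancing.minMass (Balancing.marginX P) (Balancing.marginY P)
      let q : ℝ := Balancing.minMass PXε PYε
      let L : ℝ := Real.log (1 / (1 - ε))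
      (n : ℝ) ≥ C * (Real.logb 2 (2 * n / q) + m * Real.log (n + 1)) / (min p q) ^ 2 →
      Balancing.mse ρ Z P h PXε PYε k ≤
        Balancing.sigmaSq P h k / n
        + K * ‖h‖ ^ 2 * Real.log (n + 1) ^ a *
          ((k : ℝ) ^ 6 / (q ^ 4 * (n : ℝ) ^ (3 / 2 : ℝ)))
        + K * ‖h‖ ^ 2 * Real.log (n + 1) ^ a *
          ((k : ℝ) ^ 4 / q ^ 2 * (Real.sqrt (1 / n * L) + L) *
            ((k : ℝ) ^ 2 / q ^ 2 * (Real.sqrt (1 / n * L) + L + 1 / n) + 1 / Real.sqrt n))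
        + K * ‖h‖ ^ 2 * Real.log (n + 1) ^ a *
          ((k : ℝ) ^ 2 *
            (Real.sqrt ε *
              (q ^ 4 / (n : ℝ) ^ 4 + 1 / Real.sqrt n
                + q ^ 2 * k / (n : ℝ) ^ 4 * (n + (k : ℝ) ^ 2 / q ^ 2)
                + (k : ℝ) ^ 2 / q ^ 2 * (1 / n + Real.sqrt (1 / n * L) + L))
              + ε)) := by
  -- The exponent `a = 0` suffices since the fourth moment bound carries no logarithm; `m * m` is
  -- the number of cells.
  refine ⟨1, one_pos, 0, fun m => ⟨10000000 * (1 + 144 * ((m * m : ℕ) : ℝ) ^ 4), by positivity, ?_⟩⟩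
  intro 𝒳 𝒴 _ _ _ _ _ _ hX hY P hP hPX hPY QX QY hQX hQY hQX0 hQY0 ε hε hε1 h k n hk hn Ω _ ρ _ Z
    hZ hind hZP PXε PYε p q L _
  have hne : Nonempty (𝒳 × 𝒴) := by
    by_contra hc
    rw [not_nonempty_iff] at hc
    simpa using hP.2
  obtain ⟨⟨x₀, y₀⟩⟩ := hne
  have : Nonempty 𝒳 := ⟨x₀⟩
  have : Nonempty 𝒴 := ⟨y₀⟩
  -- Any coupling of `QX` and `QY` would serve to realise the targets as marginals of a joint law
  -- near `P`; the product is the simplest.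
  have hQ := Balancing.mul_mem_stdSimplex hQX hQY
  have hP' := Balancing.mixture_mem_stdSimplex hε hε1.le hP hQ
  have hmX := Balancing.marginX_mixture_mul ε P QX hQY
  have hmY := Balancing.marginY_mixture_mul ε P QY hQX
  have hPpos : ∀ j z, 0 < Balancing.fibreSum j P z := fun j z => by
    unfold Balancing.fibreSum
    split_ifs
    exacts [hPX _, hPY _]
  have hmix : ∀ {a b : ℝ}, 0 < a → 0 < b → 0 < (1 - ε) * a + ε * b := fun ha hb =>
    add_pos_of_pos_of_nonneg (mul_pos (by linarith) ha) (mul_nonneg hε hb.le)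
  have hq : 0 < q := Balancing.minMass_pos (fun x => hmix (hPX x) (hQX0 x))
    fun y => hmix (hPY y) (hQY0 y)
  have hL : ε ≤ L := by
    have h1 := Real.log_le_sub_one_of_pos (show 0 < 1 - ε by linarith)
    simp only [L, one_div, Real.log_inv]
    linarith
  have hmse := Balancing.mse_le (H := ‖h‖) (k := k) hn hZ hind hZP hP hP' hPpos hq
    (fun j z => by
      have h1 := Balancing.minMass_le_fibreSum
        (Balancing.mixture ε P fun z => QX z.1 * QY z.2) j z
      rwa [hmX, hmY] at h1)
    hε hε1.le (Balancing.sum_abs_mixture_sub_le hε hP hQ) (norm_le_pi_norm h) hk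
  rw [hmX, hmY, Fintype.card_prod, hX, hY] at hmse
  refine hmse.trans ?_
  rw [add_assoc, add_assoc, pow_zero, mul_one, ← mul_add, ← mul_add, ← add_assoc (_ / _ : ℝ)]
  refine add_le_add_right (mul_le_mul_of_nonneg_left ?_ (by positivity)) _
  -- The last block of the rate plays the role of `D`: only its nonnegativity matters.
  exact Balancing.remainder_le hq hε hL (by have := hε.trans hL; positivity)
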